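/- Let $d\ge 1$, let $\Omega\subset\mathbb R^d$ be a bounded open set (in particular, any bounded domain with smooth boundary is allowed), and let $T>0$. Let $f=(f_1,\dots,f_d)$ with $f_i\in C^1(\mathbb R)$ and $f_i'\in L^\infty(\mathbb R)$, and let $B_{ij}\in C^3(\mathbb R)\cap L^\infty(\mathbb R)$ $(1\le i,j\le d)$ be such that for some $\theta>0$ $$\sum_{i,j=1}^d B_{ij}(s)\,\xi_i\xi_j\ \ge\ \theta|\xi|^2\qquad\text{for all } s\in\mathbb R,\ \xi\in\mathbb R^d .$$ Here $H^1_0(\Omega)$ is the closure of $C_c^\infty(\Omega)$ in $H^1(\Omega)$, with norm $\|v\|_{H^1_0(\Omega)}^2=\|v\|_{L^2(\Omega)}^2+\|\nabla v\|_{L^2(\Omega)}^2$ and the corresponding inner product; $H^{-1}(\Omega)$ is its dual, with the dual norm; $(\cdot,\cdot)$ is the inner product of $L^2(\Omega)$; and $g\in L^2(\Omega)$ is regarded as the element $v\mapsto (g,v)$ of $H^{-1}(\Omega)$. Then there is a constant $A>0$, depending only on $\Omega,T,f,(B_{ij})$, with the following property. Let $u_0\in L^\infty(\Omega)$, let $(w_k)_{k\ge1}$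 be an orthogonal basis of $H^1_0(\Omega)$ that is also an orthonormal basis of $L^2(\Omega)$, let $m\ge 1$, and let $u_m(t)=\sum_{k=1}^m C_m^k(t)\,w_k$ be a Galerkin approximation, that is, the functions $C_m^k$ are differentiable on $[0,T]$ and for $k=1,\dots,m$ satisfy $$\big(C_m^k\big)'(t)+\sum_{i,j=1}^d\Big(B_{ij}(u_m)\frac{\partial u_m}{\partial x_j},\frac{\partial w_k}{\partial x_i}\Big)+\sum_{i=1}^d\Big(f_i'(u_m)\frac{\partial u_m}{\partial x_i},w_k\Big)=0\quad(0\le t\le T),\qquad C_m^k(0)=(u_0,w_k).$$ Then $t\mapsto\|u_m(t)\|_{L^2(\Omega)}$ attains its maximum on $[0,T]$, $u_m\in L^2(0,T;H^1_0(\Omega))$, the derivative $\frac{\partial u_m}{\partial t}$ exists on $(0,T)$ and belongs to $L^2(0,T;H^{-1}(\Omega))$, and $$\max_{0\le t\le T}\|u_m(t)\|_{L^2(\Omega)}+\|u_m\|_{L^2(0,T;H^1_0(\Omega))}+\Big\|\frac{\partial u_m}{\partial t}\Big\|_{L^2(0,T;H^{-1}(\Omega))}\ \le\ A\,\|u_0\|_{L^2(\Omega)}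 .$$ -/

import Mathlib

open MeasureTheory Set
open scoped ENNReal ContDiff

noncomputable section

namespace QuasilinearGalerkin

/-! ### Function spaces on a set `Ω ⊆ ℝ^d` -/

/-- `L²(Ω)`. -/
abbrev L2 {d : ℕ} (Ω : Set (EuclideanSpace ℝ (Fin d))) : Type :=
  Lp ℝ 2 ((volume : Measure (EuclideanSpace ℝ (Fin d))).restrict Ω)

/-- `L²(Ω; ℝ^d)`. -/
abbrev L2Vec {d : ℕ} (Ω : Set (EuclideanSpace ℝ (Fin d))) : Type :=
  Lp (EuclideanSpace ℝ (Fin d)) 2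
    ((volume : Measure (EuclideanSpace ℝ (Fin d))).restrict Ω)

/-- The Hilbert space `L²(Ω) × L²(Ω; ℝ^d)` with norm `‖(v, g)‖² = ‖v‖² + ‖g‖²`. An element `v` of
`H¹(Ω)` is represented by the pair `(v, ∇v)`, so the norm restricts to the usual `H¹(Ω)` norm. -/
abbrev L2Pair {d : ℕ} (Ω : Set (EuclideanSpace ℝ (Fin d))) : Type :=
  WithLp 2 (L2 Ω × L2Vec Ω)

/-- `φ ∈ C_c^∞(Ω)`. -/
def IsTestFunction {d : ℕ} (Ω : Set (EuclideanSpace ℝ (Fin d)))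
    (φ : EuclideanSpace ℝ (Fin d) → ℝ) : Prop :=
  ContDiff ℝ ∞ φ ∧ HasCompactSupport φ ∧ tsupport φ ⊆ Ω

/-- `g` is the weak gradient of `v` on `Ω`: `∫_Ω v ∂_iφ dx = - ∫_Ω g_i φ dx` for all
`φ ∈ C_c^∞(Ω)` and all `i`. -/
def HasWeakGradient {d : ℕ} {Ω : Set (EuclideanSpace ℝ (Fin d))} (v : L2 Ω) (g : L2Vec Ω) : Prop :=
  ∀ φ : EuclideanSpace ℝ (Fin d) → ℝ, IsTestFunction Ω φ → ∀ i : Fin d,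
    ∫ x in Ω, v x * gradient φ x i = - ∫ x in Ω, g x i * φ x

/-- The pairs `(φ, ∇φ)` with `φ ∈ C_c^∞(Ω)`. -/
def testPairs {d : ℕ} (Ω : Set (EuclideanSpace ℝ (Fin d))) : Submodule ℝ (L2Pair Ω) where
  carrier := {p | ∃ φ : EuclideanSpace ℝ (Fin d) → ℝ, IsTestFunction Ω φ ∧
    p.fst =ᵐ[volume.restrict Ω] φ ∧ p.snd =ᵐ[volume.restrict Ω] gradient φ}
  zero_mem' := by
    refine ⟨0, ⟨contDiff_const, HasCompactSupport.zero, by simp [tsupport]⟩, ?_, ?_⟩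
    · exact Lp.coeFn_zero _ _ _
    · refine (Lp.coeFn_zero _ _ _).trans (Filter.Eventually.of_forall fun x => ?_)
      simp [gradient]
  add_mem' := by
    rintro p q ⟨φ, hφ, hp1, hp2⟩ ⟨ψ, hψ, hq1, hq2⟩
    refine ⟨φ + ψ, ⟨hφ.1.add hψ.1, hφ.2.1.add hψ.2.1,
      (tsupport_add φ ψ).trans (union_subset hφ.2.2 hψ.2.2)⟩, ?_, ?_⟩
    · exact (Lp.coeFn_add _ _).trans (hp1.add hq1)
    · refine (Lp.coeFn_add _ _).trans ((hp2.add hq2).trans (Filter.Eventually.of_forall fun x => ?_))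
      have h1 := (hφ.1.differentiable (by simp)).differentiableAt (x := x)
      have h2 := (hψ.1.differentiable (by simp)).differentiableAt (x := x)
      simp [gradient, fderiv_add h1 h2]
  smul_mem' := by
    rintro c p ⟨φ, hφ, hp1, hp2⟩
    refine ⟨c • φ, ⟨hφ.1.const_smul c, hφ.2.1.smul_left (f := fun _ => c),
      (tsupport_smul_subset_right (fun _ => c) φ).trans hφ.2.2⟩, ?_, ?_⟩
    · exact (Lp.coeFn_smul _ _).trans (hp1.const_smul c)
    · refine (Lp.coeFn_smul _ _).trans ((hp2.const_smul c).trans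
        (Filter.Eventually.of_forall fun x => ?_))
      have h1 := (hφ.1.differentiable (by simp)).differentiableAt (x := x)
      simp [gradient, fderiv_const_smul h1]

/-- `H¹₀(Ω)`: the closure of `C_c^∞(Ω)` in the `H¹(Ω)` norm, with the `H¹(Ω)` inner product
`∫_Ω v w dx + ∫_Ω ∇v · ∇w dx`. -/
def H10 {d : ℕ} (Ω : Set (EuclideanSpace ℝ (Fin d))) : Submodule ℝ (L2Pair Ω) :=
  (testPairs Ω).topologicalClosure

/-- The embedding `H¹₀(Ω) → L²(Ω)`. -/
def toL2 {d : ℕ} (Ω : Set (EuclideanSpace ℝ (Fin d))) : H10 Ω →L[ℝ] L2 Ω :=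
  (WithLp.fstL 2 ℝ (L2 Ω) (L2Vec Ω)).comp (H10 Ω).subtypeL

/-- The weak gradient `H¹₀(Ω) → L²(Ω; ℝ^d)`. -/
def grad {d : ℕ} (Ω : Set (EuclideanSpace ℝ (Fin d))) : H10 Ω →L[ℝ] L2Vec Ω :=
  (WithLp.sndL 2 ℝ (L2 Ω) (L2Vec Ω)).comp (H10 Ω).subtypeL

/-- `H⁻¹(Ω)`, the dual of `H¹₀(Ω)` with the dual norm. -/
abbrev Hneg1 {d : ℕ} (Ω : Set (EuclideanSpace ℝ (Fin d))) : Type :=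
  StrongDual ℝ (H10 Ω)

/-- The embedding `L²(Ω) → H⁻¹(Ω)`, `⟨g, v⟩ = ∫_Ω g v dx`. -/
def L2toHneg1 {d : ℕ} (Ω : Set (EuclideanSpace ℝ (Fin d))) (g : L2 Ω) : Hneg1 Ω :=
  (innerSL ℝ g).comp (toL2 Ω)

/-- The second component of an element of `H¹₀(Ω)` is indeed its weak gradient. -/
theorem hasWeakGradient_grad {d : ℕ} (Ω : Set (EuclideanSpace ℝ (Fin d))) (v : H10 Ω) :
    HasWeakGradient (toL2 Ω v) (grad Ω v) := by
  intro φ hφ i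
  have hsub : ∀ x, x ∉ Ω → φ x = 0 := fun x hx =>
    image_eq_zero_of_notMem_tsupport fun h => hx (hφ.2.2 h)
  have hfd : Continuous (fderiv ℝ φ) := hφ.1.continuous_fderiv (by simp)
  have hgrad : ∀ x, gradient φ x i = fderiv ℝ φ x (EuclideanSpace.single i 1) := by
    intro x
    have h := InnerProductSpace.toDual_symm_apply (𝕜 := ℝ) (x := EuclideanSpace.single i (1 : ℝ))
      (y := fderiv ℝ φ x)
    rw [← h, EuclideanSpace.inner_single_right]
    simp [gradient]
  have hdφ : Continuous fun x => gradient φ x i := by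
    simp only [hgrad]
    fun_prop
  have hsuppD : HasCompactSupport fun x => gradient φ x i := by
    simp only [hgrad]
    exact hφ.2.1.fderiv_apply (𝕜 := ℝ) _
  have hmD : MemLp (fun x => gradient φ x i) 2 (volume.restrict Ω) :=
    (hdφ.memLp_of_hasCompactSupport hsuppD).restrict Ω
  have hmφ : MemLp (fun x => φ x • EuclideanSpace.single i (1 : ℝ)) 2 (volume.restrict Ω) :=
    Continuous.memLp_of_hasCompactSupport (hφ.1.continuous.smul continuous_const)
      hφ.2.1.smul_right
  let F : L2Pair Ω → ℝ := fun p => inner ℝ p.fst (hmD.toLp _) + inner ℝ p.snd (hmφ.toLp _)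
  have hF : Continuous F := by
    have h1 : Continuous fun p : L2Pair Ω => p.fst := (WithLp.fstL 2 ℝ (L2 Ω) (L2Vec Ω)).continuous
    have h2 : Continuous fun p : L2Pair Ω => p.snd := (WithLp.sndL 2 ℝ (L2 Ω) (L2Vec Ω)).continuous
    exact (h1.inner continuous_const).add (h2.inner continuous_const)
  have hFeq : ∀ p : L2Pair Ω, F p =
      (∫ x in Ω, p.fst x * gradient φ x i) + ∫ x in Ω, p.snd x i * φ x := by
    intro p
    simp only [F, L2.inner_def]
    congr 1
    · refine integral_congr_ae ?_
      filter_upwards [hmD.coeFn_toLp] with x hx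
      rw [hx]
      simp [mul_comm]
    · refine integral_congr_ae ?_
      filter_upwards [hmφ.coeFn_toLp] with x hx
      rw [hx]
      simp [inner_smul_right, EuclideanSpace.inner_single_right, mul_comm]
  have hzero : ∀ p ∈ testPairs Ω, F p = 0 := by
    rintro p ⟨ψ, hψ, hp1, hp2⟩
    have hgradψ : ∀ x, gradient ψ x i = fderiv ℝ ψ x (EuclideanSpace.single i 1) := by
      intro x
      have h := InnerProductSpace.toDual_symm_apply (𝕜 := ℝ)
        (x := EuclideanSpace.single i (1 : ℝ)) (y := fderiv ℝ ψ x)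
      rw [← h, EuclideanSpace.inner_single_right]
      simp [gradient]
    have hfψ : Continuous (fderiv ℝ ψ) := hψ.1.continuous_fderiv (by simp)
    have e1 : ∫ x in Ω, p.fst x * gradient φ x i =
        ∫ x, ψ x * fderiv ℝ φ x (EuclideanSpace.single i 1) := by
      rw [← setIntegral_eq_integral_of_forall_compl_eq_zero (s := Ω) (μ := volume)
        (f := fun x => ψ x * fderiv ℝ φ x (EuclideanSpace.single i 1))]
      · refine integral_congr_ae ?_
        filter_upwards [hp1] with x hx
        rw [hx, hgrad]
      · intro x hx
        rw [image_eq_zero_of_notMem_tsupport fun h => hx (hψ.2.2 h), zero_mul]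
    have e2 : ∫ x in Ω, p.snd x i * φ x =
        ∫ x, fderiv ℝ ψ x (EuclideanSpace.single i 1) * φ x := by
      rw [← setIntegral_eq_integral_of_forall_compl_eq_zero (s := Ω) (μ := volume)
        (f := fun x => fderiv ℝ ψ x (EuclideanSpace.single i 1) * φ x)]
      · refine integral_congr_ae ?_
        filter_upwards [hp2] with x hx
        rw [hx, hgradψ]
      · intro x hx
        rw [hsub x hx, mul_zero]
    rw [hFeq, e1, e2, integral_mul_fderiv_eq_neg_fderiv_mul_of_integrable, neg_add_cancel]
    · exact Continuous.integrable_of_hasCompactSupport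
        ((hfψ.clm_apply continuous_const).mul hφ.1.continuous) hφ.2.1.mul_left
    · exact Continuous.integrable_of_hasCompactSupport
        (hψ.1.continuous.mul (hfd.clm_apply continuous_const)) hψ.2.1.mul_right
    · exact Continuous.integrable_of_hasCompactSupport
        (hψ.1.continuous.mul hφ.1.continuous) hφ.2.1.mul_left
    · exact fun x _ => (hψ.1.differentiable (by simp)).differentiableAt
    · exact fun x _ => (hφ.1.differentiable (by simp)).differentiableAt
  have hv : F (v : L2Pair Ω) = 0 :=
    closure_minimal (t := {p | F p = 0}) hzero (isClosed_eq hF continuous_const) v.2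
  rw [hFeq] at hv
  exact eq_neg_of_add_eq_zero_left hv

/-! ### Coefficients -/

/-- `f ∈ (C¹(ℝ))^d` and `f' ∈ (L^∞(ℝ))^d`. -/
def FluxHyp {d : ℕ} (f : Fin d → ℝ → ℝ) : Prop :=
  (∀ i, ContDiff ℝ 1 (f i)) ∧ ∃ K : ℝ, ∀ i s, |deriv (f i) s| ≤ K

/-- `B_{ij} ∈ C³(ℝ) ∩ L^∞(ℝ)`, and `∑ B_{ij}(s) ξ_i ξ_j ≥ θ |ξ|²` for some `θ > 0` and all
`s ∈ ℝ`, `ξ ∈ ℝ^d`. -/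
def DiffusionHyp {d : ℕ} (B : Fin d → Fin d → ℝ → ℝ) : Prop :=
  (∀ i j, ContDiff ℝ 3 (B i j)) ∧ (∃ K : ℝ, ∀ i j s, |B i j s| ≤ K) ∧
    ∃ θ : ℝ, 0 < θ ∧ ∀ (s : ℝ) (ξ : EuclideanSpace ℝ (Fin d)),
      θ * ‖ξ‖ ^ 2 ≤ ∑ i, ∑ j, B i j s * ξ i * ξ j

/-! ### Galerkin approximations -/

/-- `(w_k)` is an orthogonal basis of `H¹₀(Ω)` and an orthonormal basis of `L²(Ω)`. -/
def IsGalerkinBasis {d : ℕ} {Ω : Set (EuclideanSpace ℝ (Fin d))} (w : ℕ → H10 Ω) : Prop :=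
  ((∀ k l, k ≠ l → inner ℝ (w k) (w l) = 0) ∧
    (Submodule.span ℝ (range w)).topologicalClosure = ⊤) ∧
  (Orthonormal ℝ (fun k => toL2 Ω (w k)) ∧
    (Submodule.span ℝ (range fun k => toL2 Ω (w k))).topologicalClosure = ⊤)

/-- The function `u_m(t) = ∑_{k=1}^m C_m^k(t) w_k` (indices are shifted to start from `0`). -/
def galerkinSum {d : ℕ} {Ω : Set (EuclideanSpace ℝ (Fin d))} (w : ℕ → H10 Ω) {m : ℕ}
    (C : Fin m → ℝ → ℝ) (t : ℝ) : H10 Ω :=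
  ∑ k : Fin m, C k t • w k

/-- The form `∑_{i,j} (B_{ij}(v) ∂_j v, ∂_i w) + ∑_i (f_i'(v) ∂_i v, w)`, where `(·,·)` is the
inner product of `L²(Ω)`. -/
def weakForm {d : ℕ} {Ω : Set (EuclideanSpace ℝ (Fin d))} (f : Fin d → ℝ → ℝ)
    (B : Fin d → Fin d → ℝ → ℝ) (v w : H10 Ω) : ℝ :=
  (∑ i, ∑ j, ∫ x in Ω, B i j (toL2 Ω v x) * grad Ω v x j * grad Ω w x i) +
    ∑ i, ∫ x in Ω, deriv (f i) (toL2 Ω v x) * grad Ω v x i * toL2 Ω w x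

/-- `C = (C_m^1, …, C_m^m)` solves on `[0,T]` the initial value problem
`(C_m^k)' + ∑_{i,j} (B_{ij}(u_m) ∂_j u_m, ∂_i w_k) + ∑_i (f_i'(u_m) ∂_i u_m, w_k) = 0`,
`C_m^k(0) = (u_0, w_k)`, for `k = 1, …, m`. -/
def IsGalerkinSolution {d : ℕ} {Ω : Set (EuclideanSpace ℝ (Fin d))} (f : Fin d → ℝ → ℝ)
    (B : Fin d → Fin d → ℝ → ℝ) (T : ℝ) (u₀ : L2 Ω) (w : ℕ → H10 Ω) {m : ℕ}
    (C : Fin m → ℝ → ℝ) : Prop :=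
  ∀ k : Fin m, C k 0 = inner ℝ u₀ (toL2 Ω (w k)) ∧
    ∀ t ∈ Icc 0 T,
      HasDerivWithinAt (C k) (-weakForm f B (galerkinSum w C t) (w k)) (Icc 0 T) t

/-- The norm of `L²(0,T;X)`, for functions that belong to this space. -/
def L2TimeNorm {X : Type*} [NormedAddCommGroup X] (T : ℝ) (v : ℝ → X) : ℝ :=
  √(∫ t in Ioo 0 T, ‖v t‖ ^ 2)

end QuasilinearGalerkin

end

open QuasilinearGalerkin

/-!
The estimates are the classical energy estimates for Galerkin approximations. Write `a(u; v)` for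
`weakForm f B u v`.

* `a` is linear and bounded in `v`, with `|a(u; v)| ≤ Λ ‖u‖ ‖v‖` in the norm of `H¹₀`
  (`abs_weakForm_le`), and satisfies a Gårding inequality
  `θ ‖∇u‖² ≤ a(u; u) + κ ‖∇u‖ ‖u‖` (`garding`); all constants depend on `f`, `B` and `d` only.
* Testing the equations with `u` gives `d/dt ‖u‖² = -2 a(u; u) ≤ -θ ‖∇u‖² + (κ²/θ) ‖u‖²`. With
  the exponential weight of Grönwall's lemma absorbed into the energy, one monotone quantity
  controls both `max ‖u‖` and `∫ ‖∇u‖²` (`IsGalerkinSolution.energy_le`), and Bessel's inequality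
  bounds its initial value by `‖u₀‖²`.
* In `H⁻¹`, the derivative of `u` is the functional `v ↦ -a(u; P v)`, where `P` is the
  `L²`-orthogonal projection onto the span of `w_0, …, w_{m-1}`. Since the `w_k` are orthogonal
  in both `L²` and `H¹₀`, `P` is also the orthogonal projection of `H¹₀`, hence contractive there
  (`norm_galerkinProj_le`). So `‖u'‖ ≤ Λ ‖u‖`, uniformly in `m` and in the basis.
-/

namespace QuasilinearGalerkin

/-! ### Trilinear integrals with a bounded coefficient -/

section Coefficient

variable {α : Type*} [MeasurableSpace α] {μ : Measure α}

/-- The weighted `L²` pairing `∫ b(v) p q dμ`. -/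
noncomputable def coeffPairing (b : ℝ → ℝ) (v p q : Lp ℝ 2 μ) : ℝ :=
  ∫ x, b (v x) * p x * q x ∂μ

theorem integrable_coeff_mul {b : ℝ → ℝ} (hb : Continuous b) {K : ℝ} (hK : ∀ s, |b s| ≤ K)
    (v p q : Lp ℝ 2 μ) : Integrable (fun x => b (v x) * p x * q x) μ := by
  simp only [mul_assoc]
  exact ((Lp.memLp p).integrable_mul (Lp.memLp q)).bdd_mul
    (hb.comp_aestronglyMeasurable (Lp.memLp v).1) (.of_forall fun x => hK _)

theorem abs_coeffPairing_le {b : ℝ → ℝ} {K : ℝ} (hK : ∀ s, |b s| ≤ K)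
    (v p q : Lp ℝ 2 μ) : |coeffPairing b v p q| ≤ K * (‖p‖ * ‖q‖) := by
  have hK0 : 0 ≤ K := (abs_nonneg _).trans (hK 0)
  have hint : Integrable (fun x => K * (|p x| * |q x|)) μ :=
    ((Lp.memLp p).abs.integrable_mul (Lp.memLp q).abs).const_mul K
  have hle : ∀ᵐ x ∂μ, ‖b (v x) * p x * q x‖ ≤ K * (|p x| * |q x|) := .of_forall fun x => by
    rw [Real.norm_eq_abs, abs_mul, abs_mul, mul_assoc]
    gcongr
    exact hK _
  have habs : ∫ x, |p x| * |q x| ∂μ = inner ℝ |p| |q| := by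
    rw [L2.inner_def]
    refine integral_congr_ae ?_
    filter_upwards [Lp.coeFn_abs p, Lp.coeFn_abs q] with x hp hq
    rw [hp, hq]
    simp [mul_comm]
  calc |coeffPairing b v p q| ≤ ∫ x, K * (|p x| * |q x|) ∂μ :=
        norm_integral_le_of_norm_le hint hle
    _ = K * inner ℝ |p| |q| := by rw [integral_const_mul, habs]
    _ ≤ K * (‖p‖ * ‖q‖) := by
        gcongr
        simpa only [norm_abs_eq_norm] using real_inner_le_norm |p| |q|

theorem coeffPairing_add {b : ℝ → ℝ} (hb : Continuous b) {K : ℝ} (hK : ∀ s, |b s| ≤ K)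
    (v p q r : Lp ℝ 2 μ) :
    coeffPairing b v p (q + r) = coeffPairing b v p q + coeffPairing b v p r := by
  unfold coeffPairing
  rw [← integral_add (integrable_coeff_mul hb hK v p q) (integrable_coeff_mul hb hK v p r)]
  refine integral_congr_ae ?_
  filter_upwards [Lp.coeFn_add q r] with x hx
  rw [hx, Pi.add_apply, mul_add]

theorem coeffPairing_smul (b : ℝ → ℝ) (v p q : Lp ℝ 2 μ) (c : ℝ) :
    coeffPairing b v p (c • q) = c * coeffPairing b v p q := by
  unfold coeffPairing
  rw [← integral_const_mul]
  refine integral_congr_ae ?_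
  filter_upwards [Lp.coeFn_smul c q] with x hx
  rw [hx, Pi.smul_apply, smul_eq_mul]
  ring

end Coefficient

/-! ### The weak form -/

variable {d : ℕ} {Ω : Set (EuclideanSpace ℝ (Fin d))}

/-- The `i`-th coordinate of a vector field, as a bounded operator `L²(Ω; ℝ^d) → L²(Ω)`. -/
noncomputable def coord (Ω : Set (EuclideanSpace ℝ (Fin d))) (i : Fin d) : L2Vec Ω →L[ℝ] L2 Ω :=
  (EuclideanSpace.proj i : EuclideanSpace ℝ (Fin d) →L[ℝ] ℝ).compLpL 2 (volume.restrict Ω)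

theorem coeFn_coord (i : Fin d) (g : L2Vec Ω) :
    coord Ω i g =ᵐ[volume.restrict Ω] fun x => g x i :=
  ContinuousLinearMap.coeFn_compLpL _ g

theorem norm_coord_le (i : Fin d) (g : L2Vec Ω) : ‖coord Ω i g‖ ≤ ‖g‖ := by
  have h : ‖(EuclideanSpace.proj i : EuclideanSpace ℝ (Fin d) →L[ℝ] ℝ)‖ ≤ 1 :=
    ContinuousLinearMap.opNorm_le_bound _ zero_le_one fun x => by
      simpa using PiLp.norm_apply_le x i
  calc ‖coord Ω i g‖ ≤ _ * ‖g‖ := ContinuousLinearMap.norm_compLp_le _ g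
    _ ≤ 1 * ‖g‖ := by gcongr
    _ = ‖g‖ := one_mul _

theorem norm_sq_eq (v : H10 Ω) : ‖v‖ ^ 2 = ‖toL2 Ω v‖ ^ 2 + ‖grad Ω v‖ ^ 2 :=
  WithLp.prod_norm_sq_eq_of_L2 (v : L2Pair Ω)

theorem norm_toL2_le (v : H10 Ω) : ‖toL2 Ω v‖ ≤ ‖v‖ :=
  le_of_sq_le_sq (by nlinarith [norm_sq_eq v, sq_nonneg ‖grad Ω v‖]) (norm_nonneg _)

theorem norm_grad_le (v : H10 Ω) : ‖grad Ω v‖ ≤ ‖v‖ :=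
  le_of_sq_le_sq (by nlinarith [norm_sq_eq v, sq_nonneg ‖toL2 Ω v‖]) (norm_nonneg _)

theorem weakForm_eq (f : Fin d → ℝ → ℝ) (B : Fin d → Fin d → ℝ → ℝ) (v w : H10 Ω) :
    weakForm f B v w =
      (∑ i, ∑ j, coeffPairing (B i j) (toL2 Ω v) (coord Ω j (grad Ω v)) (coord Ω i (grad Ω w))) +
        ∑ i, coeffPairing (deriv (f i)) (toL2 Ω v) (coord Ω i (grad Ω v)) (toL2 Ω w) := by
  unfold weakForm coeffPairing
  congr 1
  · refine Finset.sum_congr rfl fun i _ => Finset.sum_congr rfl fun j _ => integral_congr_ae ?_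
    filter_upwards [coeFn_coord j (grad Ω v), coeFn_coord i (grad Ω w)] with x hv hw
    rw [hv, hw]
  · refine Finset.sum_congr rfl fun i _ => integral_congr_ae ?_
    filter_upwards [coeFn_coord i (grad Ω v)] with x hv
    rw [hv]

section Bounds

variable {f : Fin d → ℝ → ℝ} {B : Fin d → Fin d → ℝ → ℝ}

/-- The linear functional `weakForm f B v`. -/
noncomputable def weakFormLinear (hf : FluxHyp f) (hB : DiffusionHyp B) (v : H10 Ω) :
    H10 Ω →ₗ[ℝ] ℝ where
  toFun := weakForm f B v
  map_add' w z := by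
    obtain ⟨hf1, Kf, hKf⟩ := hf
    obtain ⟨hB1, ⟨KB, hKB⟩, -⟩ := hB
    have e1 := fun i j p => coeffPairing_add (hB1 i j).continuous (hKB i j) (toL2 Ω v) p
    have e2 := fun i p =>
      coeffPairing_add ((hf1 i).continuous_deriv le_rfl) (hKf i) (toL2 Ω v) p
    simp only [weakForm_eq, map_add, e1, e2, Finset.sum_add_distrib]
    ring
  map_smul' c w := by
    simp only [weakForm_eq, map_smul, coeffPairing_smul, ← Finset.mul_sum, smul_eq_mul,
      RingHom.id_apply, mul_add]

theorem weakForm_sum_smul (hf : FluxHyp f) (hB : DiffusionHyp B) (v : H10 Ω) {ι : Type*}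
    (s : Finset ι) (a : ι → ℝ) (w : ι → H10 Ω) :
    weakForm f B v (∑ k ∈ s, a k • w k) = ∑ k ∈ s, a k * weakForm f B v (w k) := by
  have h := map_sum (weakFormLinear hf hB v) (fun k => a k • w k) s
  simp only [map_smul, smul_eq_mul] at h
  exact h

theorem abs_weakForm_le {KB Kf : ℝ} (hKB : ∀ i j s, |B i j s| ≤ KB)
    (hKf : ∀ i s, |deriv (f i) s| ≤ Kf) (v w : H10 Ω) :
    |weakForm f B v w| ≤ (d * (d * |KB|) + d * |Kf|) * ‖v‖ * ‖w‖ := by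
  have hv (j : Fin d) : ‖coord Ω j (grad Ω v)‖ ≤ ‖v‖ := (norm_coord_le j _).trans (norm_grad_le v)
  have hw (j : Fin d) : ‖coord Ω j (grad Ω w)‖ ≤ ‖w‖ := (norm_coord_le j _).trans (norm_grad_le w)
  have h1 (i j : Fin d) : |coeffPairing (B i j) (toL2 Ω v) (coord Ω j (grad Ω v))
      (coord Ω i (grad Ω w))| ≤ |KB| * (‖v‖ * ‖w‖) := by
    refine (abs_coeffPairing_le (fun s => (hKB i j s).trans (le_abs_self _)) _ _ _).trans ?_
    gcongr
    exacts [hv j, hw i]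
  have h2 (i : Fin d) : |coeffPairing (deriv (f i)) (toL2 Ω v) (coord Ω i (grad Ω v))
      (toL2 Ω w)| ≤ |Kf| * (‖v‖ * ‖w‖) := by
    refine (abs_coeffPairing_le (fun s => (hKf i s).trans (le_abs_self _)) _ _ _).trans ?_
    gcongr
    exacts [hv i, norm_toL2_le w]
  rw [weakForm_eq]
  calc _ ≤ (∑ _i : Fin d, ∑ _j : Fin d, |KB| * (‖v‖ * ‖w‖)) +
        ∑ _i : Fin d, |Kf| * (‖v‖ * ‖w‖) := by
        refine (abs_add_le _ _).trans (add_le_add ?_ ?_)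
        · refine (Finset.abs_sum_le_sum_abs _ _).trans (Finset.sum_le_sum fun i _ => ?_)
          exact (Finset.abs_sum_le_sum_abs _ _).trans (Finset.sum_le_sum fun j _ => h1 i j)
        · exact (Finset.abs_sum_le_sum_abs _ _).trans (Finset.sum_le_sum fun i _ => h2 i)
    _ = _ := by
        simp only [Finset.sum_const, Finset.card_univ, Fintype.card_fin, nsmul_eq_mul]
        ring

/-- Ellipticity of the diffusion and boundedness of the convection give a Gårding inequality. -/
theorem garding (hB : DiffusionHyp B) {θ Kf : ℝ}
    (hθ : ∀ (s : ℝ) (ξ : EuclideanSpace ℝ (Fin d)), θ * ‖ξ‖ ^ 2 ≤ ∑ i, ∑ j, B i j s * ξ i * ξ j)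
    (hKf : ∀ i s, |deriv (f i) s| ≤ Kf) (v : H10 Ω) :
    θ * ‖grad Ω v‖ ^ 2 ≤ weakForm f B v v + d * |Kf| * ‖grad Ω v‖ * ‖toL2 Ω v‖ := by
  obtain ⟨hB1, ⟨KB, hKB⟩, -⟩ := hB
  have hint (i j : Fin d) := integrable_coeff_mul (hB1 i j).continuous (hKB i j) (toL2 Ω v)
    (coord Ω j (grad Ω v)) (coord Ω i (grad Ω v))
  have hsum : ∑ i, ∑ j, coeffPairing (B i j) (toL2 Ω v) (coord Ω j (grad Ω v))
      (coord Ω i (grad Ω v)) = ∫ x in Ω, ∑ i, ∑ j, B i j (toL2 Ω v x) *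
        coord Ω j (grad Ω v) x * coord Ω i (grad Ω v) x := by
    rw [integral_finsetSum _ fun i _ => integrable_finsetSum _ fun j _ => hint i j]
    exact Finset.sum_congr rfl fun i _ => (integral_finsetSum _ fun j _ => hint i j).symm
  have hdiff : θ * ‖grad Ω v‖ ^ 2 ≤ ∑ i, ∑ j, coeffPairing (B i j) (toL2 Ω v)
      (coord Ω j (grad Ω v)) (coord Ω i (grad Ω v)) := by
    rw [hsum, ← real_inner_self_eq_norm_sq, L2.inner_def, ← integral_const_mul]
    refine integral_mono_ae ((L2.integrable_inner (𝕜 := ℝ) _ _).const_mul θ)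
      (integrable_finsetSum _ fun i _ => integrable_finsetSum _ fun j _ => hint i j) ?_
    filter_upwards [ae_all_iff.2 fun i => coeFn_coord i (grad Ω v)] with x hx
    simp only [hx, real_inner_self_eq_norm_sq]
    refine (hθ (toL2 Ω v x) (grad Ω v x)).trans_eq ?_
    exact Finset.sum_congr rfl fun i _ => Finset.sum_congr rfl fun j _ => by ring
  have hconv : |∑ i, coeffPairing (deriv (f i)) (toL2 Ω v) (coord Ω i (grad Ω v)) (toL2 Ω v)| ≤
      d * |Kf| * ‖grad Ω v‖ * ‖toL2 Ω v‖ := by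
    calc _ ≤ ∑ _i : Fin d, |Kf| * (‖grad Ω v‖ * ‖toL2 Ω v‖) := by
          refine (Finset.abs_sum_le_sum_abs _ _).trans (Finset.sum_le_sum fun i _ => ?_)
          refine (abs_coeffPairing_le (fun s => (hKf i s).trans (le_abs_self _)) _ _ _).trans ?_
          gcongr
          exact norm_coord_le i _
      _ = _ := by
          simp only [Finset.sum_const, Finset.card_univ, Fintype.card_fin, nsmul_eq_mul]
          ring
  rw [weakForm_eq]
  linarith [neg_abs_le
    (∑ i, coeffPairing (deriv (f i)) (toL2 Ω v) (coord Ω i (grad Ω v)) (toL2 Ω v))]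

end Bounds

/-! ### The Galerkin projection -/

theorem IsGalerkinBasis.orthonormal_fin {w : ℕ → H10 Ω} (hw : IsGalerkinBasis w) (m : ℕ) :
    Orthonormal ℝ fun k : Fin m => toL2 Ω (w k) :=
  hw.2.1.comp (fun k : Fin m => (k : ℕ)) Fin.val_injective

/-- As `(w_k)` is orthogonal in `H¹₀` and orthonormal in `L²`, the two inner products with `w_k`
are proportional: they are on the basis, hence on its closed span. -/
theorem inner_basis_eq {w : ℕ → H10 Ω} (hw : IsGalerkinBasis w) (k : ℕ) (v : H10 Ω) :
    inner ℝ (w k) v = ‖w k‖ ^ 2 * inner ℝ (toL2 Ω (w k)) (toL2 Ω v) := by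
  obtain ⟨⟨horth, hdense⟩, hon, -⟩ := hw
  let F : H10 Ω →L[ℝ] ℝ := innerSL ℝ (w k)
  let G : H10 Ω →L[ℝ] ℝ := ‖w k‖ ^ 2 • (innerSL ℝ (toL2 Ω (w k))).comp (toL2 Ω)
  have hFG : F = G := by
    refine ContinuousLinearMap.ext_on
      (Submodule.dense_iff_topologicalClosure_eq_top.2 hdense) ?_
    rintro _ ⟨l, rfl⟩
    have hL2 := orthonormal_iff_ite.1 hon k l
    by_cases hkl : k = l
    · subst hkl
      simp [F, G, hon.1]
    · rw [if_neg hkl] at hL2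
      simp [F, G, hL2, horth k l hkl]
  exact congrArg (fun L : H10 Ω →L[ℝ] ℝ => L v) hFG

/-- The `L²`-orthogonal projection of `v` onto the span of `w_0, …, w_{m-1}`. -/
noncomputable def galerkinProj (w : ℕ → H10 Ω) (m : ℕ) (v : H10 Ω) : H10 Ω :=
  ∑ k : Fin m, (inner ℝ (toL2 Ω (w k)) (toL2 Ω v) : ℝ) • w k

/-- The `L²`-orthogonal projection is also orthogonal in `H¹₀`, hence contractive there. -/
theorem norm_galerkinProj_le {w : ℕ → H10 Ω} (hw : IsGalerkinBasis w) (m : ℕ) (v : H10 Ω) :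
    ‖galerkinProj w m v‖ ≤ ‖v‖ := by
  have hcoef (k : Fin m) : (inner ℝ (toL2 Ω (w k)) (toL2 Ω (galerkinProj w m v)) : ℝ) =
      inner ℝ (toL2 Ω (w k)) (toL2 Ω v) := by
    simp only [galerkinProj, map_sum, map_smul]
    exact (hw.orthonormal_fin m).inner_right_fintype _ k
  have hexp (z : H10 Ω) : (inner ℝ (galerkinProj w m v) z : ℝ) = ∑ k : Fin m,
      inner ℝ (toL2 Ω (w k)) (toL2 Ω v) * (‖w k‖ ^ 2 * inner ℝ (toL2 Ω (w k)) (toL2 Ω z)) := by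
    rw [galerkinProj, sum_inner]
    refine Finset.sum_congr rfl fun k _ => ?_
    rw [← inner_basis_eq hw]
    exact real_inner_smul_left (w k) z _
  have hinner : (inner ℝ (galerkinProj w m v) (galerkinProj w m v) : ℝ) =
      inner ℝ (galerkinProj w m v) v := by
    rw [hexp, hexp]
    simp only [hcoef]
  have h := real_inner_le_norm (galerkinProj w m v) v
  rw [← hinner, real_inner_self_eq_norm_sq, sq] at h
  by_contra! hlt
  nlinarith [norm_nonneg v]

/-! ### Square integrability in time -/

section Time

variable {X Y : Type*} [NormedAddCommGroup X] [NormedAddCommGroup Y] {T : ℝ}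

theorem memLp_two_of_continuousOn {u : ℝ → X} (hu : ContinuousOn u (Icc 0 T)) :
    MemLp u 2 (volume.restrict (Ioo 0 T)) := by
  have := secondCountableTopologyEither_of_left ℝ X
  obtain ⟨D, hD⟩ := isCompact_Icc.exists_bound_of_continuousOn hu
  exact .of_bound ((hu.mono Ioo_subset_Icc_self).aestronglyMeasurable measurableSet_Ioo) D
    (ae_restrict_of_forall_mem measurableSet_Ioo fun t ht => hD t (Ioo_subset_Icc_self ht))

theorem L2TimeNorm_le_mul {u : ℝ → X} {v : ℝ → Y} {Λ : ℝ} (hΛ : 0 ≤ Λ)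
    (hu : MemLp u 2 (volume.restrict (Ioo 0 T))) (hv : MemLp v 2 (volume.restrict (Ioo 0 T)))
    (hle : ∀ t ∈ Ioo 0 T, ‖v t‖ ≤ Λ * ‖u t‖) : L2TimeNorm T v ≤ Λ * L2TimeNorm T u := by
  have h1 : ∫ t in Ioo 0 T, ‖v t‖ ^ 2 ≤ Λ ^ 2 * ∫ t in Ioo 0 T, ‖u t‖ ^ 2 := by
    rw [← integral_const_mul]
    refine setIntegral_mono_on (hv.integrable_norm_pow two_ne_zero)
      ((hu.integrable_norm_pow two_ne_zero).const_mul _) measurableSet_Ioo fun t ht => ?_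
    rw [← mul_pow]
    gcongr
    exact hle t ht
  refine (Real.sqrt_le_sqrt h1).trans_eq ?_
  rw [Real.sqrt_mul (by positivity), Real.sqrt_sq hΛ, L2TimeNorm]

/-- Measurability of `v'` is automatic, as it is a derivative. The codomain is stated as a dual
space so that the topology in `HasDerivAt` is syntactically the one elaborated for `Hneg1`. -/
theorem memLp_two_of_hasDerivAt {V : Type*} [NormedAddCommGroup V] [NormedSpace ℝ V]
    {u : ℝ → X} {v v' : ℝ → StrongDual ℝ V} {Λ : ℝ}
    (hu : MemLp u 2 (volume.restrict (Ioo 0 T)))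
    (hderiv : ∀ t ∈ Ioo 0 T, HasDerivAt v (v' t) t)
    (hle : ∀ t ∈ Ioo 0 T, ‖v' t‖ ≤ Λ * ‖u t‖) :
    MemLp v' 2 (volume.restrict (Ioo 0 T)) := by
  have := secondCountableTopologyEither_of_left ℝ (StrongDual ℝ V)
  have hmeas : AEStronglyMeasurable v' (volume.restrict (Ioo 0 T)) :=
    (stronglyMeasurable_deriv v).aestronglyMeasurable.congr
      (ae_restrict_of_forall_mem measurableSet_Ioo fun t ht => (hderiv t ht).deriv)
  exact hu.of_le_mul hmeas (ae_restrict_of_forall_mem measurableSet_Ioo hle)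

/-- The codomain is a dual space for the same reason as in `memLp_two_of_hasDerivAt`. -/
theorem hasDerivAt_clm_comp {V : Type*} [NormedAddCommGroup V] [NormedSpace ℝ V]
    [NormedSpace ℝ X] (J : X →L[ℝ] StrongDual ℝ V) {u : ℝ → X} {u' : X} {t : ℝ}
    (h : HasDerivAt u u' t) : HasDerivAt (fun s => J (u s)) (J u') t :=
  J.hasFDerivAt.comp_hasDerivAt t h

end Time

/-! ### Energy estimates for Galerkin solutions -/

section Energy

variable {f : Fin d → ℝ → ℝ} {B : Fin d → Fin d → ℝ → ℝ} {T : ℝ} {u₀ : L2 Ω} {w : ℕ → H10 Ω}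
  {m : ℕ} {C : Fin m → ℝ → ℝ}

theorem toL2_galerkinSum (w : ℕ → H10 Ω) (C : Fin m → ℝ → ℝ) (t : ℝ) :
    toL2 Ω (galerkinSum w C t) = ∑ k : Fin m, C k t • toL2 Ω (w k) := by
  simp only [galerkinSum, map_sum, map_smul]

theorem IsGalerkinSolution.hasDerivWithinAt (h : IsGalerkinSolution f B T u₀ w C) {t : ℝ}
    (ht : t ∈ Icc 0 T) :
    HasDerivWithinAt (galerkinSum w C)
      (∑ k : Fin m, (-weakForm f B (galerkinSum w C t) (w k)) • w k) (Icc 0 T) t :=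
  HasDerivWithinAt.fun_sum fun k _ => ((h k).2 t ht).smul_const (w k)

theorem IsGalerkinSolution.continuousOn (h : IsGalerkinSolution f B T u₀ w C) :
    ContinuousOn (galerkinSum w C) (Icc 0 T) :=
  fun _ ht => (h.hasDerivWithinAt ht).continuousWithinAt

/-- The energy identity `d/dt ‖u‖² = -2 a(u; u)` for `a = weakForm f B`, obtained by
testing the equations with `u`. -/
theorem IsGalerkinSolution.hasDerivWithinAt_norm_sq (hf : FluxHyp f) (hB : DiffusionHyp B)
    (hw : IsGalerkinBasis w) (h : IsGalerkinSolution f B T u₀ w C) {t : ℝ} (ht : t ∈ Icc 0 T) :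
    HasDerivWithinAt (fun s => ‖toL2 Ω (galerkinSum w C s)‖ ^ 2)
      (-2 * weakForm f B (galerkinSum w C t) (galerkinSum w C t)) (Icc 0 T) t := by
  have hd := ((toL2 Ω).hasFDerivAt.comp_hasDerivWithinAt t (h.hasDerivWithinAt ht)).norm_sq
  refine hd.congr_deriv ?_
  have hform := weakForm_sum_smul hf hB (galerkinSum w C t) Finset.univ (fun k => C k t)
    (fun k : Fin m => w k)
  change weakForm f B (galerkinSum w C t) (galerkinSum w C t) = _ at hform
  rw [hform]
  simp only [Function.comp_apply, map_sum, map_smul, toL2_galerkinSum]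
  rw [(hw.orthonormal_fin m).inner_sum, Finset.mul_sum, Finset.mul_sum]
  refine Finset.sum_congr rfl fun k _ => ?_
  simp only [conj_trivial]
  ring

/-- Bessel's inequality for the initial value. -/
theorem IsGalerkinSolution.norm_zero_le (hw : IsGalerkinBasis w)
    (h : IsGalerkinSolution f B T u₀ w C) : ‖toL2 Ω (galerkinSum w C 0)‖ ≤ ‖u₀‖ := by
  have hon := hw.orthonormal_fin m
  refine le_of_sq_le_sq ?_ (norm_nonneg _)
  rw [← real_inner_self_eq_norm_sq, toL2_galerkinSum, hon.inner_sum]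
  refine le_trans (le_of_eq ?_) (hon.sum_inner_products_le (s := Finset.univ) u₀)
  refine Finset.sum_congr rfl fun k _ => ?_
  rw [(h k).1, Real.norm_eq_abs, sq_abs, real_inner_comm]
  simp [sq]

/-- The integrated energy inequality, in the form in which Grönwall's factor `exp (-c t)` has been
absorbed into the energy. In front of `‖∇u‖²` the weight is replaced by its
minimum `exp (-c T)`, which keeps the integrand free of exponentials. -/
theorem IsGalerkinSolution.energy_le (hf : FluxHyp f) (hB : DiffusionHyp B)
    (hw : IsGalerkinBasis w) (h : IsGalerkinSolution f B T u₀ w C) {θ κ : ℝ} (hθ : 0 < θ)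
    (hgar : ∀ v : H10 Ω,
      θ * ‖grad Ω v‖ ^ 2 ≤ weakForm f B v v + κ * ‖grad Ω v‖ * ‖toL2 Ω v‖)
    {t : ℝ} (ht : t ∈ Icc 0 T) :
    Real.exp (-(κ ^ 2 / θ * t)) * ‖toL2 Ω (galerkinSum w C t)‖ ^ 2 +
        θ * Real.exp (-(κ ^ 2 / θ * T)) * ∫ s in 0..t, ‖grad Ω (galerkinSum w C s)‖ ^ 2 ≤
      ‖u₀‖ ^ 2 := by
  have hT : (0 : ℝ) ≤ T := ht.1.trans ht.2
  set c := κ ^ 2 / θ with hc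
  have hc0 : 0 ≤ c := by positivity
  set G : ℝ → ℝ := fun s => ‖grad Ω (galerkinSum w C s)‖ ^ 2 with hG
  have hGcont : ContinuousOn G (Icc 0 T) :=
    (((grad Ω).continuous.comp_continuousOn h.continuousOn).norm).pow 2
  let E : ℝ → ℝ := fun s => Real.exp (-(c * s)) * ‖toL2 Ω (galerkinSum w C s)‖ ^ 2 +
    θ * Real.exp (-(c * T)) * ∫ r in 0..s, G r
  have hderiv (s : ℝ) (hs : s ∈ Icc 0 T) : HasDerivWithinAt E
      ((Real.exp (-(c * s)) * (-c) * ‖toL2 Ω (galerkinSum w C s)‖ ^ 2 + Real.exp (-(c * s)) *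
        (-2 * weakForm f B (galerkinSum w C s) (galerkinSum w C s))) +
        θ * Real.exp (-(c * T)) * G s) (Icc 0 T) s := by
    have h1 : HasDerivAt (fun s => Real.exp (-(c * s))) (Real.exp (-(c * s)) * (-c)) s := by
      simpa using ((hasDerivAt_id s).const_mul c).neg.exp
    have h2 : HasDerivWithinAt (fun s => ∫ r in 0..s, G r) (G s) (Icc 0 T) s := by
      have : Fact (s ∈ Icc 0 T) := ⟨hs⟩
      refine intervalIntegral.integral_hasDerivWithinAt_right ?_ ?_ (hGcont s hs)
      · refine (hGcont.mono ?_).intervalIntegrable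
        rw [uIcc_of_le hs.1]
        exact Icc_subset_Icc_right hs.2
      · exact hGcont.stronglyMeasurableAtFilter_nhdsWithin measurableSet_Icc s
    exact (h1.hasDerivWithinAt.mul (h.hasDerivWithinAt_norm_sq hf hB hw hs)).add
      (h2.const_mul _)
  have hanti : AntitoneOn E (Icc 0 T) := by
    refine antitoneOn_of_deriv_nonpos (convex_Icc 0 T)
      (fun s hs => (hderiv s hs).continuousWithinAt) (fun s hs => ?_) (fun s hs => ?_)
    · exact ((hderiv s (interior_subset hs)).mono interior_subset).differentiableWithinAt
    · rw [((hderiv s (interior_subset hs)).hasDerivAt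
        (mem_interior_iff_mem_nhds.1 hs)).deriv]
      have hsT : s ≤ T := (interior_subset hs).2
      set v := galerkinSum w C s
      have hexp : Real.exp (-(c * T)) ≤ Real.exp (-(c * s)) :=
        Real.exp_le_exp.2 (by nlinarith)
      -- Young's inequality `2 κ |∇v| |v| ≤ θ |∇v|² + c |v|²` absorbs the convection term.
      have hyoung : 2 * (κ * ‖grad Ω v‖ * ‖toL2 Ω v‖) ≤
          θ * ‖grad Ω v‖ ^ 2 + c * ‖toL2 Ω v‖ ^ 2 := by
        have hsq : 0 ≤ θ * (‖grad Ω v‖ - κ / θ * ‖toL2 Ω v‖) ^ 2 := by positivity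
        have heq : θ * (‖grad Ω v‖ - κ / θ * ‖toL2 Ω v‖) ^ 2 = θ * ‖grad Ω v‖ ^ 2 -
            2 * (κ * ‖grad Ω v‖ * ‖toL2 Ω v‖) + c * ‖toL2 Ω v‖ ^ 2 := by
          rw [hc]
          field_simp
          ring
        linarith
      have hmain : -c * ‖toL2 Ω v‖ ^ 2 - 2 * weakForm f B v v + θ * G s ≤ 0 := by
        have := hgar v
        simp only [hG]
        change -c * ‖toL2 Ω v‖ ^ 2 - 2 * weakForm f B v v + θ * ‖grad Ω v‖ ^ 2 ≤ 0
        linarith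
      have hGs : 0 ≤ θ * G s := by positivity
      nlinarith [mul_le_mul_of_nonneg_right hexp hGs,
        mul_nonpos_of_nonneg_of_nonpos (Real.exp_pos (-(c * s))).le hmain]
  refine (hanti (left_mem_Icc.2 hT) ht ht.1).trans ?_
  have h0 := h.norm_zero_le hw
  simp only [E, mul_zero, neg_zero, Real.exp_zero, one_mul, intervalIntegral.integral_same,
    add_zero]
  gcongr

/-- The functional `v ↦ -a(u; P v)`, for `a = weakForm f B` and `P` the Galerkin projection,
is the time derivative of the solution in `H⁻¹`; as `P` is contractive in `H¹₀`, its norm is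
controlled by that of `u`. -/
theorem norm_L2toHneg1_sum_le (hf : FluxHyp f) (hB : DiffusionHyp B) (hw : IsGalerkinBasis w)
    {Λ : ℝ} (hΛ0 : 0 ≤ Λ) (hΛ : ∀ v z : H10 Ω, |weakForm f B v z| ≤ Λ * ‖v‖ * ‖z‖) (m : ℕ)
    (u : H10 Ω) :
    ‖L2toHneg1 Ω (toL2 Ω (∑ k : Fin m, (-weakForm f B u (w k)) • w k))‖ ≤ Λ * ‖u‖ := by
  refine ContinuousLinearMap.opNorm_le_bound _ (by positivity) fun v => ?_
  have heq : L2toHneg1 Ω (toL2 Ω (∑ k : Fin m, (-weakForm f B u (w k)) • w k)) v =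
      -weakForm f B u (galerkinProj w m v) := by
    rw [galerkinProj, weakForm_sum_smul hf hB, ← Finset.sum_neg_distrib]
    change (inner ℝ (toL2 Ω (∑ k : Fin m, (-weakForm f B u (w k)) • w k)) (toL2 Ω v) : ℝ) = _
    simp only [map_sum, map_smul, sum_inner, real_inner_smul_left]
    exact Finset.sum_congr rfl fun k _ => by ring
  rw [heq, norm_neg, Real.norm_eq_abs]
  refine (hΛ _ _).trans ?_
  gcongr
  exact norm_galerkinProj_le hw m v

/-- `L2toHneg1` as a bounded linear operator. -/
noncomputable def L2toHneg1Linear (Ω : Set (EuclideanSpace ℝ (Fin d))) : L2 Ω →L[ℝ] Hneg1 Ω :=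
  LinearMap.mkContinuous
    { toFun := L2toHneg1 Ω
      map_add' := fun g k => by
        ext v
        exact inner_add_left g k (toL2 Ω v)
      map_smul' := fun c g => by
        ext v
        exact real_inner_smul_left g (toL2 Ω v) c }
    ‖toL2 Ω‖ fun g => by
      refine ContinuousLinearMap.opNorm_le_bound _ (by positivity) fun v => ?_
      calc ‖L2toHneg1 Ω g v‖ ≤ ‖g‖ * ‖toL2 Ω v‖ := norm_inner_le_norm (𝕜 := ℝ) g (toL2 Ω v)
        _ ≤ ‖g‖ * (‖toL2 Ω‖ * ‖v‖) := by
            gcongr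
            exact (toL2 Ω).le_opNorm v
        _ = ‖toL2 Ω‖ * ‖g‖ * ‖v‖ := by ring

theorem IsGalerkinSolution.hasDerivAt_L2toHneg1 (h : IsGalerkinSolution f B T u₀ w C) {t : ℝ}
    (ht : t ∈ Ioo 0 T) :
    HasDerivAt (fun s => L2toHneg1 Ω (toL2 Ω (galerkinSum w C s)))
      (L2toHneg1 Ω (toL2 Ω (∑ k : Fin m, (-weakForm f B (galerkinSum w C t) (w k)) • w k))) t := by
  have hd := (h.hasDerivWithinAt (Ioo_subset_Icc_self ht)).hasDerivAt (Icc_mem_nhds ht.1 ht.2)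
  have hd' := (toL2 Ω).hasFDerivAt.comp_hasDerivAt t hd
  exact hasDerivAt_clm_comp (V := H10 Ω) (L2toHneg1Linear Ω) hd'

/-- Uniform bound in `L²(Ω)`. -/
theorem IsGalerkinSolution.norm_toL2_sq_le (hf : FluxHyp f) (hB : DiffusionHyp B)
    (hw : IsGalerkinBasis w) (h : IsGalerkinSolution f B T u₀ w C) {θ κ : ℝ} (hθ : 0 < θ)
    (hgar : ∀ v : H10 Ω,
      θ * ‖grad Ω v‖ ^ 2 ≤ weakForm f B v v + κ * ‖grad Ω v‖ * ‖toL2 Ω v‖)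
    {t : ℝ} (ht : t ∈ Icc 0 T) :
    ‖toL2 Ω (galerkinSum w C t)‖ ^ 2 ≤ Real.exp (κ ^ 2 / θ * T) * ‖u₀‖ ^ 2 := by
  have hint : 0 ≤ ∫ s in 0..t, ‖grad Ω (galerkinSum w C s)‖ ^ 2 :=
    intervalIntegral.integral_nonneg ht.1 fun _ _ => by positivity
  have hexp : (Real.exp (κ ^ 2 / θ * T))⁻¹ ≤ Real.exp (-(κ ^ 2 / θ * t)) := by
    rw [← Real.exp_neg]
    gcongr
    exact ht.2
  rw [← inv_mul_le_iff₀ (Real.exp_pos _)]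
  refine le_trans ?_ (h.energy_le hf hB hw hθ hgar ht)
  refine le_add_of_le_of_nonneg ?_ (by positivity)
  gcongr

theorem IsGalerkinSolution.integral_norm_grad_sq_le (hf : FluxHyp f) (hB : DiffusionHyp B)
    (hw : IsGalerkinBasis w) (h : IsGalerkinSolution f B T u₀ w C) {θ κ : ℝ} (hθ : 0 < θ)
    (hgar : ∀ v : H10 Ω,
      θ * ‖grad Ω v‖ ^ 2 ≤ weakForm f B v v + κ * ‖grad Ω v‖ * ‖toL2 Ω v‖) (hT : 0 ≤ T) :
    ∫ s in 0..T, ‖grad Ω (galerkinSum w C s)‖ ^ 2 ≤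
      Real.exp (κ ^ 2 / θ * T) / θ * ‖u₀‖ ^ 2 := by
  have h1 : θ * Real.exp (-(κ ^ 2 / θ * T)) * ∫ s in 0..T, ‖grad Ω (galerkinSum w C s)‖ ^ 2 ≤
      ‖u₀‖ ^ 2 :=
    (le_add_of_nonneg_left (by positivity)).trans
      (h.energy_le hf hB hw hθ hgar (right_mem_Icc.2 hT))
  rw [Real.exp_neg] at h1
  generalize Real.exp (κ ^ 2 / θ * T) = R, Real.exp_pos (κ ^ 2 / θ * T) = hR at h1 ⊢
  generalize ∫ s in 0..T, ‖grad Ω (galerkinSum w C s)‖ ^ 2 = I at h1 ⊢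
  have h2 : R / θ * (θ * R⁻¹ * I) = I := by
    field_simp
  rw [← h2]
  gcongr

/-- Bound in `L²(0,T; H¹₀(Ω))`. -/
theorem IsGalerkinSolution.L2TimeNorm_le (hf : FluxHyp f) (hB : DiffusionHyp B)
    (hw : IsGalerkinBasis w) (h : IsGalerkinSolution f B T u₀ w C) {θ κ : ℝ} (hθ : 0 < θ)
    (hgar : ∀ v : H10 Ω,
      θ * ‖grad Ω v‖ ^ 2 ≤ weakForm f B v v + κ * ‖grad Ω v‖ * ‖toL2 Ω v‖) (hT : 0 ≤ T) :
    L2TimeNorm T (galerkinSum w C) ≤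
      √(T * Real.exp (κ ^ 2 / θ * T) + Real.exp (κ ^ 2 / θ * T) / θ) * ‖u₀‖ := by
  have hi1 : IntervalIntegrable (fun t => ‖toL2 Ω (galerkinSum w C t)‖ ^ 2) volume 0 T :=
    ContinuousOn.intervalIntegrable (by
      rw [uIcc_of_le hT]
      exact ((toL2 Ω).continuous.comp_continuousOn h.continuousOn).norm.pow 2)
  have hi2 : IntervalIntegrable (fun t => ‖grad Ω (galerkinSum w C t)‖ ^ 2) volume 0 T :=
    ContinuousOn.intervalIntegrable (by
      rw [uIcc_of_le hT]
      exact ((grad Ω).continuous.comp_continuousOn h.continuousOn).norm.pow 2)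
  have hint : ∫ t in Ioo 0 T, ‖galerkinSum w C t‖ ^ 2 ≤
      (T * Real.exp (κ ^ 2 / θ * T) + Real.exp (κ ^ 2 / θ * T) / θ) * ‖u₀‖ ^ 2 := by
    rw [← integral_Ioc_eq_integral_Ioo, ← intervalIntegral.integral_of_le hT]
    simp only [norm_sq_eq]
    rw [intervalIntegral.integral_add hi1 hi2, add_mul]
    refine add_le_add ?_ (h.integral_norm_grad_sq_le hf hB hw hθ hgar hT)
    calc ∫ t in 0..T, ‖toL2 Ω (galerkinSum w C t)‖ ^ 2
        ≤ ∫ _t in 0..T, Real.exp (κ ^ 2 / θ * T) * ‖u₀‖ ^ 2 :=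
          intervalIntegral.integral_mono_on hT hi1 (by simp)
            fun t ht => h.norm_toL2_sq_le hf hB hw hθ hgar ht
      _ = T * Real.exp (κ ^ 2 / θ * T) * ‖u₀‖ ^ 2 := by
          rw [intervalIntegral.integral_const, sub_zero, smul_eq_mul, mul_assoc]
  refine (Real.sqrt_le_sqrt hint).trans_eq ?_
  rw [Real.sqrt_mul (by positivity), Real.sqrt_sq (norm_nonneg _)]

end Energy

end QuasilinearGalerkin

theorem theorem2p1 {d : ℕ} (hd : 1 ≤ d) (Ω : Set (EuclideanSpace ℝ (Fin d)))
    (hΩ : IsOpen Ω) (hΩb : Bornology.IsBounded Ω) (T : ℝ) (hT : 0 < T)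
    (f : Fin d → ℝ → ℝ) (hf : FluxHyp f)
    (B : Fin d → Fin d → ℝ → ℝ) (hB : DiffusionHyp B) :
    ∃ A : ℝ, 0 < A ∧
      ∀ u₀ : L2 Ω, MemLp u₀ ∞ (volume.restrict Ω) →
      ∀ w : ℕ → H10 Ω, IsGalerkinBasis w →
      ∀ (m : ℕ) (C : Fin m → ℝ → ℝ), IsGalerkinSolution f B T u₀ w C →
        ∃ (u' : ℝ → Hneg1 Ω) (M : ℝ),
          (∀ t ∈ Ioo 0 T,
            HasDerivAt (fun s => L2toHneg1 Ω (toL2 Ω (galerkinSum w C s))) (u' t) t) ∧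
          IsGreatest ((fun t => ‖toL2 Ω (galerkinSum w C t)‖) '' Icc 0 T) M ∧
          MemLp (galerkinSum w C) 2 (volume.restrict (Ioo 0 T)) ∧
          MemLp u' 2 (volume.restrict (Ioo 0 T)) ∧
          M + L2TimeNorm T (galerkinSum w C) + L2TimeNorm T u' ≤ A * ‖u₀‖ := by
  obtain ⟨Kf, hKf⟩ := hf.2
  obtain ⟨KB, hKB⟩ := hB.2.1
  obtain ⟨θ, hθ, hell⟩ := hB.2.2
  have hgar := garding (Ω := Ω) hB hell hKf
  have hform := abs_weakForm_le (Ω := Ω) hKB hKf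
  have hΛ0 : (0 : ℝ) ≤ d * (d * |KB|) + d * |Kf| := by positivity
  generalize (d : ℝ) * |Kf| = κ at hgar
  generalize (d : ℝ) * (d * |KB|) + d * |Kf| = Λ at hform hΛ0
  -- `√R` is the bound for the maximum, `S` and `Λ * S` are those for the two norms over time.
  let R : ℝ := Real.exp (κ ^ 2 / θ * T)
  let S : ℝ := √(T * R + R / θ)
  have hR : 0 < R := Real.exp_pos _
  refine ⟨√R + S + Λ * S, by positivity, fun u₀ _ w hw m C h => ?_⟩
  have hu := memLp_two_of_continuousOn h.continuousOn
  have hS : L2TimeNorm T (galerkinSum w C) ≤ S * ‖u₀‖ :=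
    h.L2TimeNorm_le hf hB hw hθ hgar hT.le
  let u' : ℝ → Hneg1 Ω := fun t =>
    L2toHneg1 Ω (toL2 Ω (∑ k : Fin m, (-weakForm f B (galerkinSum w C t) (w k)) • w k))
  have hderiv (t : ℝ) (ht : t ∈ Ioo 0 T) :
      HasDerivAt (fun s => L2toHneg1 Ω (toL2 Ω (galerkinSum w C s))) (u' t) t :=
    h.hasDerivAt_L2toHneg1 ht
  have hnorm (t : ℝ) (_ : t ∈ Ioo 0 T) : ‖u' t‖ ≤ Λ * ‖galerkinSum w C t‖ :=
    norm_L2toHneg1_sum_le hf hB hw hΛ0 hform m _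
  have hu' : MemLp u' 2 (volume.restrict (Ioo 0 T)) :=
    memLp_two_of_hasDerivAt (V := H10 Ω) hu hderiv hnorm
  have hS' := L2TimeNorm_le_mul (Y := Hneg1 Ω) (v := u') hΛ0 hu hu' hnorm
  obtain ⟨M, hM⟩ := (isCompact_Icc.image_of_continuousOn
    (((toL2 Ω).continuous.comp_continuousOn h.continuousOn).norm)).exists_isGreatest
    ((nonempty_Icc.2 hT.le).image _)
  have hMle : M ≤ √R * ‖u₀‖ := by
    obtain ⟨t, ht, rfl⟩ := hM.1
    refine (Real.le_sqrt_of_sq_le (h.norm_toL2_sq_le hf hB hw hθ hgar ht)).trans_eq ?_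
    rw [Real.sqrt_mul hR.le, Real.sqrt_sq (norm_nonneg _)]
  refine ⟨u', M, hderiv, hM, hu, hu', ?_⟩
  have hΛS := mul_le_mul_of_nonneg_left hS hΛ0
  linarith
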